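/- Let $H$ be any real Hilbert space (finite- or infinite-dimensional, possibly $0$), let $B(s\oplus u,t\oplus v)=st-\langle u,v\rangle$ on $\mathbb{R}\oplus H$, and let $\mathbf{H}_{\mathbb{R}}^{\kappa}$, where $\kappa$ is the Hilbertian dimension of $H$, be the real hyperbolic space of all lines in $\mathbb{R}\oplus H$ spanned by a vector $X$ with $B(X,X)>0$, with the distance $d\ge 0$ determined by $\cosh d(x,y)=|B(X,Y)|/(B(X,X)B(Y,Y))^{1/2}$ for vectors $X,Y$ spanning $x,y$. A real kernel $\Phi$ on a set $S$ is of positive type if it is symmetric and $\sum_{j,k}c_jc_k\Phi(x_j,x_k)\ge 0$ for all finite families $x_j\in S$, $c_j\in\mathbb{R}$. A symmetric kernel $\beta\colon S\times S\to\mathbb{R}_{\ge 0}$ equal to $1$ on the diagonal is of real hyperbolic type if for every $x_0\in S$ the kernel $(x,y)\mapsto \beta(x,x_0)\beta(x_0,y)-\beta(x,y)$ is of positive type. A kernel $\beta'$ on $S$ is an anisotropic deformation of $\beta$ if $\beta'=\cosh^2\delta\cdot\beta-\sinh^2\delta\cdot\Phi$ for some $\delta\ge 0$ and some real kernel $\Phi$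 of positive type on $S$ that equals $1$ on the diagonal. Then: 1. the kernel $(x,y)\mapsto e^{d(x,y)}$ is of real hyperbolic type on $\mathbf{H}_{\mathbb{R}}^{\kappa}$; 2. it is an anisotropic deformation of the kernel $\cosh d$; 3. for every $1\le\lambda\le e$, the kernel $(x,y)\mapsto\lambda^{d(x,y)}$ is of real hyperbolic type on $\mathbf{H}_{\mathbb{R}}^{\kappa}$; moreover, there are a real Hilbert space $K$, with associated real hyperbolic space $\mathbf{H}_{\mathbb{R}}^{\kappa'}$, and a map $f\colon\mathbf{H}_{\mathbb{R}}^{\kappa}\to\mathbf{H}_{\mathbb{R}}^{\kappa'}$ with $\lambda^{d(x,y)}=\cosh d(f(x),f(y))$ for all $x,y$. -/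

import Mathlib

universe u

/-- The Minkowski form `B (s ⊕ u, t ⊕ v) = s * t - ⟪u, v⟫` on `ℝ ⊕ H`. -/
noncomputable def minkowskiForm {H : Type*} [NormedAddCommGroup H] [InnerProductSpace ℝ H]
    (X Y : ℝ × H) : ℝ :=
  X.1 * Y.1 - inner ℝ X.2 Y.2

/-- The real hyperbolic space attached to a real Hilbert space `H`: the set of lines of `ℝ ⊕ H`
that are spanned by a `B`-positive vector. Its dimension is the Hilbertian dimension of `H`. -/
def RealHyperbolicSpace (H : Type*) [NormedAddCommGroup H] [InnerProductSpace ℝ H] : Type _ :=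
  {p : Projectivization ℝ (ℝ × H) // 0 < minkowskiForm p.rep p.rep}

namespace RealHyperbolicSpace

variable {H : Type*} [NormedAddCommGroup H] [InnerProductSpace ℝ H]

/-- A vector of `ℝ ⊕ H` spanning the line `x`. -/
noncomputable def rep (x : RealHyperbolicSpace H) : ℝ × H :=
  Projectivization.rep x.1

/-- The hyperbolic distance (curvature `-1`), that is the nonnegative number `d` with
`cosh d = |B (X, Y)| / (B (X, X) * B (Y, Y)) ^ (1 / 2)` for vectors `X`, `Y` spanning the lines
`x`, `y`. -/
noncomputable def hdist (x y : RealHyperbolicSpace H) : ℝ :=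
  Real.arcosh (|minkowskiForm x.rep y.rep| /
    √(minkowskiForm x.rep x.rep * minkowskiForm y.rep y.rep))

theorem rep_pos (x : RealHyperbolicSpace H) : 0 < minkowskiForm x.rep x.rep := x.2

theorem minkowskiForm_smul_smul (a b : ℝ) (X Y : ℝ × H) :
    minkowskiForm (a • X) (b • Y) = a * b * minkowskiForm X Y := by
  simp only [minkowskiForm, Prod.smul_fst, Prod.smul_snd, smul_eq_mul, inner_smul_left,
    inner_smul_right, conj_trivial]
  ring

/-- The distance can be computed from arbitrary vectors spanning the two lines. -/
theorem hdist_eq (x y : RealHyperbolicSpace H) (X Y : ℝ × H) (hX : X ≠ 0) (hY : Y ≠ 0)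
    (hx : x.1 = Projectivization.mk ℝ X hX) (hy : y.1 = Projectivization.mk ℝ Y hY) :
    hdist x y = Real.arcosh (|minkowskiForm X Y| /
      √(minkowskiForm X X * minkowskiForm Y Y)) := by
  obtain ⟨a, ha⟩ := Projectivization.exists_smul_eq_mk_rep ℝ X hX
  obtain ⟨b, hb⟩ := Projectivization.exists_smul_eq_mk_rep ℝ Y hY
  have hx' : x.rep = (a : ℝ) • X := by rw [rep, hx, ← ha]; rfl
  have hy' : y.rep = (b : ℝ) • Y := by rw [rep, hy, ← hb]; rfl
  have hab : |(a : ℝ) * b| ≠ 0 := abs_ne_zero.mpr (mul_ne_zero a.ne_zero b.ne_zero)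
  have h : (a : ℝ) * a * minkowskiForm X X * ((b : ℝ) * b * minkowskiForm Y Y)
      = |(a : ℝ) * b| ^ 2 * (minkowskiForm X X * minkowskiForm Y Y) := by
    rw [sq_abs]; ring
  rw [hdist, hx', hy']
  simp only [minkowskiForm_smul_smul]
  rw [h, Real.sqrt_mul (sq_nonneg _), Real.sqrt_sq (abs_nonneg _), abs_mul,
    mul_div_mul_left _ _ hab]

/-- Reverse Cauchy-Schwarz inequality for positive vectors. -/
theorem minkowskiForm_mul_le_sq (X Y : ℝ × H) (hX : 0 < minkowskiForm X X)
    (hY : 0 < minkowskiForm Y Y) :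
    minkowskiForm X X * minkowskiForm Y Y ≤ minkowskiForm X Y ^ 2 := by
  obtain ⟨s, u⟩ := X
  obtain ⟨t, v⟩ := Y
  simp only [minkowskiForm, real_inner_self_eq_norm_sq] at *
  set p := ‖u‖
  set q := ‖v‖
  set w : ℝ := inner ℝ u v
  have hp : p < |s| :=
    lt_of_pow_lt_pow_left₀ 2 (abs_nonneg s) (by rw [sq_abs]; linarith)
  have hq : q < |t| :=
    lt_of_pow_lt_pow_left₀ 2 (abs_nonneg t) (by rw [sq_abs]; linarith)
  have hst : p * q ≤ |s * t| := by
    rw [abs_mul]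
    exact mul_le_mul hp.le hq.le (norm_nonneg v) (abs_nonneg s)
  have h1 : (|s * t| - p * q) ^ 2 ≤ (s * t - w) ^ 2 := by
    rw [← sq_abs (s * t - w)]
    have hw : |w| ≤ p * q := abs_real_inner_le_norm u v
    exact pow_le_pow_left₀ (by linarith) (by linarith [abs_sub_abs_le_abs_sub (s * t) w]) 2
  have h2 : |s * t| ^ 2 = s ^ 2 * t ^ 2 := by rw [sq_abs]; ring
  have h3 : |s * t| * (p * q) * 2 ≤ s ^ 2 * q ^ 2 + p ^ 2 * t ^ 2 := by
    rw [abs_mul, ← sq_abs s, ← sq_abs t]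
    nlinarith [sq_nonneg (|s| * q - p * |t|)]
  nlinarith

/-- The defining relation of the distance, showing that `arcosh` is used on `[1, ∞)` only. -/
theorem cosh_hdist (x y : RealHyperbolicSpace H) :
    Real.cosh (hdist x y) = |minkowskiForm x.rep y.rep| /
      √(minkowskiForm x.rep x.rep * minkowskiForm y.rep y.rep) := by
  have hpos := mul_pos x.rep_pos y.rep_pos
  refine Real.cosh_arcosh ?_
  rw [one_le_div (Real.sqrt_pos.mpr hpos), ← Real.sqrt_sq_eq_abs]
  exact Real.sqrt_le_sqrt (minkowskiForm_mul_le_sq _ _ x.rep_pos y.rep_pos)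

end RealHyperbolicSpace

/-- A real kernel of positive type on a set `X`: it is symmetric and
`∑ c j * c k * Φ (x j) (x k) ≥ 0` for all finite families of points and of real numbers. -/
def IsPositiveTypeKernel {X : Type*} (Φ : X → X → ℝ) : Prop :=
  (Matrix.of Φ).PosSemidef

/-- Kernels of real hyperbolic type on a set `X`: symmetric, nonnegative, equal to `1` on the
diagonal, and such that `(x, y) ↦ β x x₀ * β x₀ y - β x y` is of positive type for every `x₀`. -/
structure IsRealHyperbolicTypeKernel {X : Type*} (β : X → X → ℝ) : Prop where
  symm : ∀ x y, β x y = β y x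
  nonneg : ∀ x y, 0 ≤ β x y
  diag : ∀ x, β x x = 1
  posType : ∀ x₀, IsPositiveTypeKernel fun x y ↦ β x x₀ * β x₀ y - β x y

/-- The kernel `β` is of the form `cosh d (f x) (f y)` for some map `f` from `X` to the real
hyperbolic space of some real Hilbert space. -/
def IsInducedFromRealHyperbolicSpace {X : Type u} (β : X → X → ℝ) : Prop :=
  ∃ (K : Type u) (_ : NormedAddCommGroup K) (_ : InnerProductSpace ℝ K) (_ : CompleteSpace K)
    (f : X → RealHyperbolicSpace K),
    ∀ x y, β x y = Real.cosh (RealHyperbolicSpace.hdist (f x) (f y))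

/-- `β'` is an anisotropic deformation of `β`: it equals `cosh² δ * β - sinh² δ * Φ` for some
`δ ≥ 0` and some real kernel `Φ` of positive type taking the value `1` on the diagonal. -/
def IsAnisotropicDeformation {X : Type*} (β β' : X → X → ℝ) : Prop :=
  ∃ (δ : ℝ) (Φ : X → X → ℝ), 0 ≤ δ ∧ IsPositiveTypeKernel Φ ∧ (∀ x, Φ x x = 1) ∧
    ∀ x y, β' x y = Real.cosh δ ^ 2 * β x y - Real.sinh δ ^ 2 * Φ x y

/-! Since exp d = 2 cosh d - exp(-d), and 2 = cosh² δ, 1 = sinh² δ for δ = arsinh 1, claim 2 amounts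
to exp(-d) being of positive type. Now q = exp(-d) is the smaller root of p(1 + q²) = 2q with p = 1
/ cosh d. It is a limit of polynomials in p with nonnegative coefficients, so by Schur products it
inherits positive type from p (`posType_exp_neg`); p itself is handled by a geometric series
(`posType_inv`). Anisotropic deformations preserve real hyperbolic type
(`of_isAnisotropicDeformation`), which gives claim 1. For claim 3, λ^d = (exp d)^t with t = log λ in
[0, 1], and such powers preserve real hyperbolic type because 1 - (1 - z)^t has nonnegative Taylor
coefficients (`rpow`). A Gram construction then gives the map f. -/

open Filter Topology

/-! ### Kernels of positive type -/

namespace IsPositiveTypeKernel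

variable {X : Type*} {Φ Ψ : X → X → ℝ}

theorem symm (h : IsPositiveTypeKernel Φ) (x y : X) : Φ x y = Φ y x := by
  simpa using h.1.apply y x

theorem sum_nonneg (h : IsPositiveTypeKernel Φ) (f : X →₀ ℝ) :
    0 ≤ f.sum fun i a ↦ f.sum fun j b ↦ a * Φ i j * b := by
  simpa using h.2 f

theorem diag_nonneg (h : IsPositiveTypeKernel Φ) (x : X) : 0 ≤ Φ x x :=
  Matrix.PosSemidef.diag_nonneg h

theorem of_gram {E : Type*} [NormedAddCommGroup E] [InnerProductSpace ℝ E] (v : X → E)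
    (h : ∀ x y, Φ x y = inner ℝ (v x) (v y)) : IsPositiveTypeKernel Φ := by
  refine ⟨?_, fun f ↦ ?_⟩
  · ext x y
    simp [h, real_inner_comm]
  · have key : (f.sum fun i a ↦ f.sum fun j b ↦ star a * Matrix.of Φ i j * b)
        = inner ℝ (f.sum fun i a ↦ a • v i) (f.sum fun i a ↦ a • v i) := by
      simp only [Finsupp.sum, sum_inner, inner_sum, inner_smul_left, inner_smul_right,
        Matrix.of_apply, h, star_trivial, conj_trivial]
      refine Finset.sum_congr rfl fun i _ ↦ ?_
      rw [Finset.mul_sum]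
      refine Finset.sum_congr rfl fun j _ ↦ ?_
      rw [real_inner_comm]
      ring
    rw [key]
    exact real_inner_self_nonneg

/-- A kernel of positive type is the Gram kernel of a map to a Hilbert space. -/
theorem exists_gram {X : Type u} {Φ : X → X → ℝ} (h : IsPositiveTypeKernel Φ) :
    ∃ (E : Type u) (_ : NormedAddCommGroup E) (_ : InnerProductSpace ℝ E) (_ : CompleteSpace E)
      (v : X → E), ∀ x y, Φ x y = inner ℝ (v x) (v y) := by
  -- The scalar kernel is read as an operator-valued kernel on `ℝ`; the feature vectors of its
  -- reproducing kernel space, evaluated at 1, give the Gram map.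
  let K : Matrix X X (ℝ →L[ℝ] ℝ) := Matrix.of fun x y ↦ Φ x y • ContinuousLinearMap.id ℝ ℝ
  have hK : K.PosSemidef := by
    have key := (RKHS.posSemidef_tfae (K := K)).out 0 2
    refine key.mpr ⟨?_, fun f ↦ ?_⟩
    · ext x y
      simp [K, Matrix.conjTranspose_apply, h.symm x y, ContinuousLinearMap.star_eq_adjoint,
        ContinuousLinearMap.adjoint_id]
    · refine (h.sum_nonneg f).trans_eq ?_
      simp only [Finsupp.sum, K, Matrix.of_apply, RCLike.re_to_real]
      refine Finset.sum_congr rfl fun i _ ↦ Finset.sum_congr rfl fun j _ ↦ ?_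
      simp [h.symm j i]
      ring
  have : Fact K.PosSemidef := ⟨hK⟩
  refine ⟨RKHS.OfKernel K, inferInstance, inferInstance, inferInstance,
    fun x ↦ RKHS.kerFun (RKHS.OfKernel K) x 1, fun x y ↦ ?_⟩
  rw [← RKHS.kernel_inner, RKHS.OfKernel.kernel_ofKernel]
  simp [K, h.symm x y]

theorem sq_le (h : IsPositiveTypeKernel Φ) (x y : X) : Φ x y ^ 2 ≤ Φ x x * Φ y y := by
  obtain ⟨E, _, _, _, v, hv⟩ := h.exists_gram
  rw [hv, hv, hv, sq]
  simpa [real_inner_comm] using real_inner_mul_inner_self_le (v x) (v y)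

theorem add (h : IsPositiveTypeKernel Φ) (h' : IsPositiveTypeKernel Ψ) :
    IsPositiveTypeKernel fun x y ↦ Φ x y + Ψ x y :=
  Matrix.PosSemidef.add h h'

theorem mul (h : IsPositiveTypeKernel Φ) (h' : IsPositiveTypeKernel Ψ) :
    IsPositiveTypeKernel fun x y ↦ Φ x y * Ψ x y :=
  Matrix.PosSemidef.hadamard h h'

theorem mul_self (a : X → ℝ) : IsPositiveTypeKernel fun x y ↦ a x * a y :=
  of_gram a fun x y ↦ by simp [mul_comm]

theorem const {c : ℝ} (hc : 0 ≤ c) : IsPositiveTypeKernel fun _ _ : X ↦ c := by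
  simpa [Real.mul_self_sqrt hc] using mul_self (X := X) fun _ ↦ √c

theorem const_mul (h : IsPositiveTypeKernel Φ) {c : ℝ} (hc : 0 ≤ c) :
    IsPositiveTypeKernel fun x y ↦ c * Φ x y :=
  (const hc).mul h

theorem pow (h : IsPositiveTypeKernel Φ) (n : ℕ) : IsPositiveTypeKernel fun x y ↦ Φ x y ^ n := by
  induction n with
  | zero => simpa using const (X := X) zero_le_one
  | succ n ih => simpa only [pow_succ] using ih.mul h

theorem sum {ι : Type*} {F : ι → X → X → ℝ} (s : Finset ι)
    (h : ∀ i, IsPositiveTypeKernel (F i)) : IsPositiveTypeKernel fun x y ↦ ∑ i ∈ s, F i x y := by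
  classical
  induction s using Finset.induction_on with
  | empty => simpa using const (X := X) le_rfl
  | insert i s hi ih => simpa only [Finset.sum_insert hi] using (h i).add ih

theorem of_tendsto {ι : Type*} {l : Filter ι} [l.NeBot] {F : ι → X → X → ℝ}
    (h : ∀ i, IsPositiveTypeKernel (F i)) (hF : ∀ x y, Tendsto (F · x y) l (𝓝 (Φ x y))) :
    IsPositiveTypeKernel Φ := by
  refine ⟨?_, fun f ↦ ?_⟩
  · ext x y
    simp only [Matrix.conjTranspose_apply, Matrix.of_apply, star_trivial]
    exact tendsto_nhds_unique (hF y x) (by simpa only [(h _).symm x y] using hF x y)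
  · refine ge_of_tendsto' (tendsto_finsetSum _ fun i _ ↦ tendsto_finsetSum _ fun j _ ↦
      ((hF i j).const_mul (star (f i))).mul_const (f j)) fun n ↦ (h n).2 f

theorem of_hasSum {F : ℕ → X → X → ℝ} (h : ∀ n, IsPositiveTypeKernel (F n))
    (hF : ∀ x y, HasSum (F · x y) (Φ x y)) : IsPositiveTypeKernel Φ :=
  of_tendsto (l := atTop) (fun n ↦ sum (Finset.range n) h) fun x y ↦ (hF x y).tendsto_sum_nat

/-- The kernel obtained by evaluating `Φ` on the measures `δ x - a x • δ x₀`. -/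
theorem sub_smul (h : IsPositiveTypeKernel Φ) (a : X → ℝ) (x₀ : X) :
    IsPositiveTypeKernel fun x y ↦
      Φ x y - a x * Φ x₀ y - a y * Φ x x₀ + a x * a y * Φ x₀ x₀ := by
  obtain ⟨E, _, _, _, v, hv⟩ := h.exists_gram
  refine of_gram (fun x ↦ v x - a x • v x₀) fun x y ↦ ?_
  simp only [hv, inner_sub_left, inner_sub_right, inner_smul_left, inner_smul_right, conj_trivial]
  ring

end IsPositiveTypeKernel

/-! ### Kernels of real hyperbolic type -/

namespace IsRealHyperbolicTypeKernel

variable {X : Type*} {β β' : X → X → ℝ}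

theorem one_le (h : IsRealHyperbolicTypeKernel β) (x y : X) : 1 ≤ β x y := by
  have h1 := (h.posType y).diag_nonneg x
  simp only [h.symm y x, h.diag] at h1
  nlinarith [h.nonneg x y]

theorem pos (h : IsRealHyperbolicTypeKernel β) (x y : X) : 0 < β x y :=
  zero_lt_one.trans_le (h.one_le x y)

/-- Rescaling the defining kernel by 1 / β(·, x₀) produces a variable z with β = β(x, x₀) β(y, x₀)
(1 - z), to which power series with nonnegative coefficients can be applied. -/
theorem posType_one_sub (h : IsRealHyperbolicTypeKernel β) (x₀ : X) :
    IsPositiveTypeKernel fun x y ↦ 1 - β x y / (β x x₀ * β y x₀) := by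
  convert (IsPositiveTypeKernel.mul_self fun x ↦ (β x x₀)⁻¹).mul (h.posType x₀) using 3 with x y
  have := (h.pos x x₀).ne'
  have := (h.pos y x₀).ne'
  rw [h.symm x₀ y]
  field_simp

/-- On the diagonal z = 1 - 1 / β(w, x₀)² lies in [0, 1); Cauchy-Schwarz extends the bound to all
pairs. -/
theorem abs_one_sub_lt_one (h : IsRealHyperbolicTypeKernel β) (x₀ x y : X) :
    |1 - β x y / (β x x₀ * β y x₀)| < 1 := by
  have hz := (h.posType_one_sub x₀).sq_le x y
  have hd (w : X) : 0 ≤ 1 - β w w / (β w x₀ * β w x₀) ∧ 1 - β w w / (β w x₀ * β w x₀) < 1 := by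
    refine ⟨(h.posType_one_sub x₀).diag_nonneg w, ?_⟩
    have := div_pos (h.pos w w) (mul_pos (h.pos w x₀) (h.pos w x₀))
    linarith
  rw [← sq_lt_one_iff_abs_lt_one]
  exact hz.trans_lt (mul_lt_one_of_nonneg_of_lt_one_left (hd x).1 (hd x).2 (hd y).2.le)

/-- Up to the rank-one factor 1 / (β(x, x₀) β(y, x₀)), 1 / β is the geometric series ∑ zⁿ. -/
theorem posType_inv (h : IsRealHyperbolicTypeKernel β) :
    IsPositiveTypeKernel fun x y ↦ (β x y)⁻¹ := by
  rcases isEmpty_or_nonempty X with hX | ⟨⟨x₀⟩⟩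
  · exact ⟨Subsingleton.elim _ _, fun f ↦ by simp [Subsingleton.elim f 0]⟩
  have hg : IsPositiveTypeKernel fun x y ↦ (1 - (1 - β x y / (β x x₀ * β y x₀)))⁻¹ :=
    .of_hasSum (fun n ↦ (h.posType_one_sub x₀).pow n) fun x y ↦
      hasSum_geometric_of_abs_lt_one (h.abs_one_sub_lt_one x₀ x y)
  convert (IsPositiveTypeKernel.mul_self fun x ↦ (β x x₀)⁻¹).mul hg using 3 with x y
  have := (h.pos x x₀).ne'
  have := (h.pos y x₀).ne'
  have := (h.pos x y).ne'
  rw [sub_sub_cancel]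
  field_simp

theorem of_isAnisotropicDeformation (h : IsRealHyperbolicTypeKernel β)
    (hd : IsAnisotropicDeformation β β') (h0 : ∀ x y, 0 ≤ β' x y) :
    IsRealHyperbolicTypeKernel β' := by
  obtain ⟨δ, Φ, -, hΦ, hΦ1, hβ⟩ := hd
  have hs := Real.cosh_sq δ
  refine ⟨fun x y ↦ by rw [hβ, hβ, h.symm x y, hΦ.symm x y], h0, fun x ↦ ?_, fun x₀ ↦ ?_⟩
  · rw [hβ, h.diag, hΦ1]
    linarith
  -- With cosh² = 1 + sinh², the kernel based at x₀ splits into a rank-one term, sinh² times Φ on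
  -- the measures δ_x - β(x, x₀) δ_{x₀}, and cosh² times the kernel of β.
  · have h1 := IsPositiveTypeKernel.mul_self fun x ↦ β' x x₀ - β x x₀
    have h2 := (hΦ.sub_smul (β · x₀) x₀).const_mul (sq_nonneg (Real.sinh δ))
    have h3 := (h.posType x₀).const_mul (sq_nonneg (Real.cosh δ))
    convert (h1.add h2).add h3 using 3 with x y
    simp only [hβ, h.symm x₀ y, hΦ.symm x₀ y, hΦ1, hs]
    ring

end IsRealHyperbolicTypeKernel

/-! ### Binomial series and powers with exponent in [0, 1] -/

/-- The coefficients of `1 - (1 - z) ^ t` are nonnegative for `0 ≤ t ≤ 1`. -/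
theorem Real.neg_one_pow_mul_choose_succ_nonneg {t : ℝ} (h0 : 0 ≤ t) (h1 : t ≤ 1) (n : ℕ) :
    0 ≤ (-1) ^ n * Ring.choose t (n + 1) := by
  induction n with
  | zero => simpa
  | succ n ih =>
    have hr : ((n : ℝ) + 2) * Ring.choose t (n + 2) = (t - (n + 1)) * Ring.choose t (n + 1) := by
      simp only [Ring.choose_eq_smul, smul_eq_mul]
      rw [descPochhammer_succ_right ℤ (n + 1), Polynomial.smeval_mul, Nat.factorial_succ (n + 1)]
      have : ((n + 1).factorial : ℝ) ≠ 0 := by positivity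
      have : (n : ℝ) + 2 ≠ 0 := by positivity
      simp [Polynomial.smeval_sub, Polynomial.smeval_X, Polynomial.smeval_natCast]
      field_simp
      ring
    have hn : (0 : ℝ) < n + 2 := by positivity
    refine nonneg_of_mul_nonneg_right (a := (n : ℝ) + 2) ?_ hn
    rw [show ((n : ℝ) + 2) * ((-1) ^ (n + 1) * Ring.choose t (n + 2))
      = (-1) ^ (n + 1) * ((n + 2) * Ring.choose t (n + 2)) by ring, hr,
      show (-1 : ℝ) ^ (n + 1) * ((t - (n + 1)) * Ring.choose t (n + 1))
      = (n + 1 - t) * ((-1) ^ n * Ring.choose t (n + 1)) by ring]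
    -- As t ≤ 1, the recurrence factor t - (n + 1) is nonpositive and absorbs the alternating sign.
    exact mul_nonneg (by have : (0 : ℝ) ≤ n := by positivity
                         linarith) ih

theorem Real.hasSum_one_sub_one_sub_rpow (t : ℝ) {z : ℝ} (hz : |z| < 1) :
    HasSum (fun n : ℕ ↦ ((-1) ^ n * Ring.choose t (n + 1)) * z ^ (n + 1)) (1 - (1 - z) ^ t) := by
  have h := (Real.one_add_rpow_hasFPowerSeriesOnBall_zero (a := t)).hasSum (y := -z)
    (by simpa [Metric.mem_eball, enorm_eq_nnnorm, ← NNReal.coe_lt_coe] using hz)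
  simp only [binomialSeries_apply, List.ofFn_const, List.prod_replicate, smul_eq_mul,
    zero_add] at h
  have h' := ((hasSum_nat_add_iff' 1).2 h).neg
  simp only [Finset.sum_range_one, Ring.choose_zero_right, pow_zero, mul_one, neg_sub,
    ← sub_eq_add_neg] at h'
  refine h'.congr_fun fun n ↦ ?_
  rw [neg_pow z (n + 1)]
  ring

namespace IsRealHyperbolicTypeKernel

theorem rpow {X : Type*} {β : X → X → ℝ} (h : IsRealHyperbolicTypeKernel β) {t : ℝ}
    (h0 : 0 ≤ t) (h1 : t ≤ 1) : IsRealHyperbolicTypeKernel fun x y ↦ β x y ^ t := by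
  refine ⟨fun x y ↦ by rw [h.symm], fun x y ↦ Real.rpow_nonneg (h.nonneg x y) t,
    fun x ↦ by simp [h.diag], fun x₀ ↦ ?_⟩
  have hg : IsPositiveTypeKernel fun x y ↦ 1 - (1 - (1 - β x y / (β x x₀ * β y x₀))) ^ t :=
    .of_hasSum (fun n ↦ ((h.posType_one_sub x₀).pow (n + 1)).const_mul
      (Real.neg_one_pow_mul_choose_succ_nonneg h0 h1 n)) fun x y ↦
      Real.hasSum_one_sub_one_sub_rpow t (h.abs_one_sub_lt_one x₀ x y)
  convert (IsPositiveTypeKernel.mul_self fun x ↦ β x x₀ ^ t).mul hg using 3 with x y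
  have hx := h.pos x x₀
  have hy := h.pos y x₀
  rw [sub_sub_cancel, Real.div_rpow (h.nonneg x y) (mul_pos hx hy).le,
    Real.mul_rpow hx.le hy.le, h.symm x₀ y]
  have := (Real.rpow_pos_of_pos hx t).ne'
  have := (Real.rpow_pos_of_pos hy t).ne'
  field_simp

end IsRealHyperbolicTypeKernel

/-! ### Positive type of exp(-d) -/

/-- Fixed point iteration for the smaller root of `p * (1 + q ^ 2) = 2 * q`. -/
noncomputable def fixedPointIterate (p : ℝ) : ℕ → ℝ
  | 0 => 0
  | n + 1 => 1 / 2 * (p * (1 + fixedPointIterate p n ^ 2))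

theorem tendsto_fixedPointIterate {p q : ℝ} (hq : 0 ≤ q) (hq1 : q ≤ 1)
    (hpq : p * (1 + q ^ 2) = 2 * q) : Tendsto (fixedPointIterate p) atTop (𝓝 q) := by
  have hp : 0 ≤ p := by
    by_contra! hp
    nlinarith [mul_pos (neg_pos.2 hp) (by positivity : 0 < 1 + q ^ 2)]
  have h0 : ∀ n, 0 ≤ fixedPointIterate p n := by
    rintro (_ | n) <;> simp only [fixedPointIterate] <;> positivity
  have hle : ∀ n, fixedPointIterate p n ≤ q := by
    intro n
    induction n with
    | zero => exact hq
    | succ n ih =>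
      have := mul_le_mul_of_nonneg_left (pow_le_pow_left₀ (h0 n) ih 2) hp
      simp only [fixedPointIterate]
      linarith
  have hmono : Monotone (fixedPointIterate p) := by
    refine monotone_nat_of_le_succ fun n ↦ ?_
    induction n with
    | zero => exact h0 1
    | succ n ih =>
      have := mul_le_mul_of_nonneg_left (pow_le_pow_left₀ (h0 n) ih 2) hp
      rw [fixedPointIterate, fixedPointIterate]
      linarith
  have hlim := tendsto_atTop_ciSup hmono ⟨q, by rintro _ ⟨n, rfl⟩; exact hle n⟩
  set L := ⨆ n, fixedPointIterate p n
  have hLq : L ≤ q := le_of_tendsto' hlim hle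
  have hL0 : 0 ≤ L := ge_of_tendsto' hlim h0
  have hL : L = 1 / 2 * (p * (1 + L ^ 2)) :=
    tendsto_nhds_unique ((tendsto_add_atTop_iff_nat 1).2 hlim)
      ((((hlim.pow 2).const_add 1).const_mul p).const_mul (1 / 2))
  -- Eliminating p: the limit is q or 1 / q. In the latter case L ≤ q ≤ 1 forces L = q = 1.
  have hprod : (q - L) * (1 - L * q) = 0 := by
    linear_combination (-(1 + L ^ 2) / 2) * hpq + (-(1 + q ^ 2)) * hL
  have : L = q := by
    rcases mul_eq_zero.1 hprod with h | h
    · linarith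
    · nlinarith
  rwa [this] at hlim

theorem IsPositiveTypeKernel.fixedPointIterate {X : Type*} {Φ : X → X → ℝ}
    (h : IsPositiveTypeKernel Φ) (n : ℕ) :
    IsPositiveTypeKernel fun x y ↦ _root_.fixedPointIterate (Φ x y) n := by
  induction n with
  | zero => exact const le_rfl
  | succ n ih => exact (h.mul ((const zero_le_one).add (ih.pow 2))).const_mul (by norm_num)

/-- If `cosh d` is of real hyperbolic type, then `exp (-d)` is of positive type. -/
theorem IsRealHyperbolicTypeKernel.posType_exp_neg {X : Type*} {d : X → X → ℝ}
    (hd : ∀ x y, 0 ≤ d x y) (h : IsRealHyperbolicTypeKernel fun x y ↦ Real.cosh (d x y)) :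
    IsPositiveTypeKernel fun x y ↦ Real.exp (-d x y) := by
  refine .of_tendsto (l := atTop) h.posType_inv.fixedPointIterate fun x y ↦ ?_
  refine tendsto_fixedPointIterate (Real.exp_pos _).le (Real.exp_le_one_iff.2 (by simp [hd])) ?_
  have h1 : Real.exp (d x y) * Real.exp (-d x y) = 1 := by rw [← Real.exp_add]; simp
  rw [inv_mul_eq_iff_eq_mul₀ (Real.cosh_pos _).ne', Real.cosh_eq]
  linear_combination -h1

/-! ### The kernels cosh d and exp d on hyperbolic space -/

namespace RealHyperbolicSpace

variable {H : Type*} [NormedAddCommGroup H] [InnerProductSpace ℝ H]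

theorem hdist_nonneg (x y : RealHyperbolicSpace H) : 0 ≤ hdist x y := by
  refine Real.arcosh_nonneg ?_
  rw [← cosh_hdist]
  exact Real.one_le_cosh _

/-- The point of hyperbolic space spanned by a positive vector. -/
noncomputable def mk (X : ℝ × H) (hX : 0 < minkowskiForm X X) : RealHyperbolicSpace H :=
  have hX0 : X ≠ 0 := by rintro rfl; simp [minkowskiForm] at hX
  ⟨Projectivization.mk ℝ X hX0, by
    obtain ⟨a, ha⟩ := Projectivization.exists_smul_eq_mk_rep ℝ X hX0
    rw [← ha, Units.smul_def, minkowskiForm_smul_smul]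
    exact mul_pos (mul_self_pos.2 a.ne_zero) hX⟩

theorem cosh_hdist_mk (X Y : ℝ × H) (hX : 0 < minkowskiForm X X) (hY : 0 < minkowskiForm Y Y) :
    Real.cosh (hdist (mk X hX) (mk Y hY)) =
      |minkowskiForm X Y| / √(minkowskiForm X X * minkowskiForm Y Y) := by
  have hX0 : X ≠ 0 := by rintro rfl; simp [minkowskiForm] at hX
  have hY0 : Y ≠ 0 := by rintro rfl; simp [minkowskiForm] at hY
  rw [hdist_eq _ _ X Y hX0 hY0 rfl rfl]
  refine Real.cosh_arcosh ?_
  rw [one_le_div (Real.sqrt_pos.mpr (mul_pos hX hY)), ← Real.sqrt_sq_eq_abs]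
  exact Real.sqrt_le_sqrt (minkowskiForm_mul_le_sq _ _ hX hY)

/-- The representative on the upper sheet of the hyperboloid. -/
noncomputable def unitRep (x : RealHyperbolicSpace H) : ℝ × H :=
  (SignType.sign x.rep.1 / √(minkowskiForm x.rep x.rep) : ℝ) • x.rep

theorem norm_rep_snd_lt (x : RealHyperbolicSpace H) : ‖x.rep.2‖ < |x.rep.1| := by
  have h := x.rep_pos
  rw [minkowskiForm, real_inner_self_eq_norm_sq] at h
  exact lt_of_pow_lt_pow_left₀ 2 (abs_nonneg _) (by rw [sq_abs]; linarith)

theorem unitRep_fst_pos (x : RealHyperbolicSpace H) : 0 < x.unitRep.1 := by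
  have h := (norm_nonneg _).trans_lt x.norm_rep_snd_lt
  rw [unitRep, Prod.smul_fst, smul_eq_mul, div_mul_eq_mul_div, sign_mul_self]
  exact div_pos h (Real.sqrt_pos.2 x.rep_pos)

theorem minkowskiForm_unitRep (x y : RealHyperbolicSpace H) :
    minkowskiForm x.unitRep y.unitRep = Real.cosh (hdist x y) := by
  have hx := x.norm_rep_snd_lt
  have hy := y.norm_rep_snd_lt
  have hi := abs_real_inner_le_norm x.rep.2 y.rep.2
  have key : (SignType.sign x.rep.1 : ℝ) * SignType.sign y.rep.1 * minkowskiForm x.rep y.rep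
      = |minkowskiForm x.rep y.rep| := by
    -- The product of the first coordinates dominates the inner product, hence decides the sign of
    -- B.
    have hlt : |(inner ℝ x.rep.2 y.rep.2 : ℝ)| < |x.rep.1 * y.rep.1| := by
      rw [abs_mul]
      exact hi.trans_lt (mul_lt_mul'' hx hy (norm_nonneg _) (norm_nonneg _))
    rw [← SignType.coe_mul, ← sign_mul, minkowskiForm]
    rcases lt_trichotomy (x.rep.1 * y.rep.1) 0 with h | h | h
    · rw [abs_of_neg h] at hlt
      rw [sign_neg h, abs_of_neg (by linarith [neg_abs_le (inner ℝ x.rep.2 y.rep.2 : ℝ)])]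
      simp
    · rw [h, abs_zero] at hlt
      exact absurd hlt (abs_nonneg _).not_gt
    · rw [abs_of_pos h] at hlt
      rw [sign_pos h, abs_of_pos (by linarith [le_abs_self (inner ℝ x.rep.2 y.rep.2 : ℝ)])]
      simp
  rw [cosh_hdist, unitRep, unitRep, minkowskiForm_smul_smul, ← key,
    Real.sqrt_mul x.rep_pos.le]
  ring

theorem isRealHyperbolicTypeKernel_cosh_hdist :
    IsRealHyperbolicTypeKernel fun x y : RealHyperbolicSpace H ↦ Real.cosh (x.hdist y) := by
  have hself (x : RealHyperbolicSpace H) : minkowskiForm x.unitRep x.unitRep = 1 := by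
    rw [minkowskiForm_unitRep, cosh_hdist, Real.sqrt_mul_self x.rep_pos.le, abs_of_pos x.rep_pos,
      div_self x.rep_pos.ne']
  refine ⟨fun x y ↦ ?_, fun x y ↦ (Real.cosh_pos _).le, fun x ↦ ?_, fun x₀ ↦ ?_⟩
  · simp only [← minkowskiForm_unitRep, minkowskiForm, real_inner_comm, mul_comm]
  · rw [← minkowskiForm_unitRep, hself]
  · have h0 := hself x₀
    have hs := (add_pos x₀.unitRep_fst_pos one_pos).ne'
    -- This is the H-component of x after the Lorentz boost sending x₀ to (1, 0); the first
    -- component becomes B(x, x₀).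
    refine .of_gram (fun x ↦ x.unitRep.2 +
      ((inner ℝ x₀.unitRep.2 x.unitRep.2 : ℝ) / (x₀.unitRep.1 + 1) - x.unitRep.1) •
        x₀.unitRep.2) fun x y ↦ ?_
    simp only [← minkowskiForm_unitRep, minkowskiForm, inner_add_left, inner_add_right,
      inner_smul_left, inner_smul_right, conj_trivial] at h0 ⊢
    rw [real_inner_comm x₀.unitRep.2 x.unitRep.2,
      show (inner ℝ x₀.unitRep.2 x₀.unitRep.2 : ℝ) = x₀.unitRep.1 * x₀.unitRep.1 - 1 by linarith]
    field_simp
    ring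

theorem isAnisotropicDeformation_exp_hdist :
    IsAnisotropicDeformation (fun x y : RealHyperbolicSpace H ↦ Real.cosh (x.hdist y))
      (fun x y ↦ Real.exp (x.hdist y)) := by
  refine ⟨Real.arsinh 1, fun x y ↦ Real.exp (-x.hdist y), Real.arsinh_nonneg_iff.2 zero_le_one,
    isRealHyperbolicTypeKernel_cosh_hdist.posType_exp_neg hdist_nonneg, fun x ↦ ?_, fun x y ↦ ?_⟩
  · have h : Real.cosh (x.hdist x) = 1 := isRealHyperbolicTypeKernel_cosh_hdist.diag x
    rw [Real.exp_eq_one_iff, neg_eq_zero]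
    by_contra hne
    exact (Real.one_lt_cosh.2 hne).ne' h
  · simp only [Real.cosh_sq, Real.sinh_arsinh, Real.cosh_eq (x.hdist y)]
    ring

end RealHyperbolicSpace

/-! ### Realisation in a hyperbolic space and conclusion -/

theorem IsRealHyperbolicTypeKernel.isInducedFromRealHyperbolicSpace {X : Type u} [Nonempty X]
    {β : X → X → ℝ} (h : IsRealHyperbolicTypeKernel β) :
    IsInducedFromRealHyperbolicSpace β := by
  obtain ⟨x₀⟩ := ‹Nonempty X›
  obtain ⟨E, _, _, _, v, hv⟩ := (h.posType x₀).exists_gram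
  -- Using β(x, x₀) as first coordinate cancels the product term in the Gram kernel, leaving β.
  have hB (x y : X) : minkowskiForm (β x x₀, v x) (β y x₀, v y) = β x y := by
    rw [minkowskiForm, ← hv, h.symm x₀ y]
    ring
  refine ⟨E, inferInstance, inferInstance, inferInstance,
    fun x ↦ .mk (β x x₀, v x) (by rw [hB, h.diag]; exact one_pos), fun x y ↦ ?_⟩
  rw [RealHyperbolicSpace.cosh_hdist_mk, hB, hB, hB, h.diag, h.diag, abs_of_pos (h.pos x y)]
  simp

instance RealHyperbolicSpace.instNonempty {H : Type*} [NormedAddCommGroup H]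
    [InnerProductSpace ℝ H] : Nonempty (RealHyperbolicSpace H) :=
  ⟨.mk (1, 0) (by simp [minkowskiForm])⟩

theorem proposition8p2 (H : Type u) [NormedAddCommGroup H] [InnerProductSpace ℝ H]
    [CompleteSpace H] :
    (IsRealHyperbolicTypeKernel fun x y : RealHyperbolicSpace H ↦ Real.exp (x.hdist y)) ∧
    IsAnisotropicDeformation (fun x y : RealHyperbolicSpace H ↦ Real.cosh (x.hdist y))
      (fun x y ↦ Real.exp (x.hdist y)) ∧
    ∀ l : ℝ, 1 ≤ l → l ≤ Real.exp 1 →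
      (IsRealHyperbolicTypeKernel fun x y : RealHyperbolicSpace H ↦ l ^ x.hdist y) ∧
      IsInducedFromRealHyperbolicSpace fun x y : RealHyperbolicSpace H ↦ l ^ x.hdist y := by
  have hexp := RealHyperbolicSpace.isRealHyperbolicTypeKernel_cosh_hdist.of_isAnisotropicDeformation
    (RealHyperbolicSpace.isAnisotropicDeformation_exp_hdist (H := H)) fun _ _ ↦ (Real.exp_pos _).le
  refine ⟨hexp, RealHyperbolicSpace.isAnisotropicDeformation_exp_hdist, fun l h1 he ↦ ?_⟩
  have hl : 0 < l := one_pos.trans_le h1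
  have hpow : IsRealHyperbolicTypeKernel fun x y : RealHyperbolicSpace H ↦ l ^ x.hdist y := by
    convert hexp.rpow (Real.log_nonneg h1) ((Real.log_le_iff_le_exp hl).2 he) using 3 with x y
    rw [← Real.exp_mul, Real.rpow_def_of_pos hl, mul_comm]
  exact ⟨hpow, hpow.isInducedFromRealHyperbolicSpace⟩
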